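/- Let $(V_s)_{s\ge 0}$ be a driftless Brownian motion with volatility $\sigma>0$ started at $V_0\in\mathbb{R}$, that is, $V_s=V_0+\sigma B_s$ with $B$ a standard Brownian motion with almost surely continuous paths, defined on a probability space $(\Omega,\Pr)$. Let $t>0$ and $M_t=\max_{s\in[0,t]}V_s$. (i) For all real $b,x$ with $V_0\le b$ and $x<b$, $$\lim_{\varepsilon\downarrow 0}\Pr\big(M_t>b \,\big|\, |V_t-x|<\varepsilon\big)=\exp\left(-\frac{2b^2-2b(x+V_0)+2xV_0}{\sigma^2 t}\right).$$ (ii) The same formula holds for the regular conditional distribution of $M_t$ given $V_t$: for almost every $x$ with respect to the law of $V_t$, for all $b\ge V_0$ with $b>x$, $$\Pr\big(M_t>b \,\big|\, V_t=x\big)=\exp\left(-\frac{2b^2-2b(x+V_0)+2xV_0}{\sigma^2 t}\right).$$ (iii) Consequently, for real $C_0$ and $y$ with $y+C_0\ge V_0$ and $y+C_0>x$, $$\Pr\big(M_t-C_0>y \,\big|\, V_t=x\big)=\exp\left(-\frac{2(y+C_0)^2-2(y+C_0)(x+V_0)+2xV_0}{\sigma^2 t}\right),$$ in the sense of (i) for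 every such $x$, $y$ and $C_0$, and in the sense of (ii) for every $C_0$, almost every $x$ with respect to the law of $V_t$, and all such $y$. -/

import Mathlib

open MeasureTheory ProbabilityTheory Filter Topology
open scoped NNReal

/-- `V` is a driftless Brownian motion with volatility `σ` started at `v₀`:
`V_s = v₀ + σ B_s` for a standard Brownian motion `B`. -/
def IsDriftlessBrownianMotion {Ω : Type*} [MeasurableSpace Ω]
    (V : ℝ≥0 → Ω → ℝ) (v₀ σ : ℝ) (P : Measure Ω) : Prop :=
  ∃ B : ℝ≥0 → Ω → ℝ, IsBrownianReal B P ∧ ∀ s ω, V s ω = v₀ + σ * B s ω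

/-- The running maximum of `V` on `[0, t]`. The paths of a Brownian motion are almost surely
continuous, so that almost surely this supremum is finite and attained. -/
noncomputable def runningMax {Ω : Type*} (V : ℝ≥0 → Ω → ℝ) (t : ℝ≥0) (ω : Ω) : ℝ :=
  sSup ((fun s => V s ω) '' Set.Icc 0 t)

/-- The `k`-th point of the uniform grid on `[0, t]` with `n + 1` cells. -/
noncomputable def uniformGrid (t : ℝ≥0) (n k : ℕ) : ℝ≥0 := t * (k / (n + 1))

/-- The sequence `x` exceeds the level `b` for the first time at the index `k`. -/
def IsFirstPassage (b : ℝ) (x : ℕ → ℝ) (k : ℕ) : Prop := b < x k ∧ ∀ j < k, x j ≤ b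

lemma uniformGrid_le {t : ℝ≥0} {n k : ℕ} (hk : k ≤ n + 1) : uniformGrid t n k ≤ t := by
  refine mul_le_of_le_one_right' (div_le_one_of_le₀ ?_ zero_le)
  exact_mod_cast hk

lemma uniformGrid_zero (t : ℝ≥0) (n : ℕ) : uniformGrid t n 0 = 0 := by simp [uniformGrid]

lemma uniformGrid_mono (t : ℝ≥0) (n : ℕ) : Monotone (uniformGrid t n) := by
  intro i j hij
  unfold uniformGrid
  gcongr

lemma dist_uniformGrid_succ (t : ℝ≥0) (n k : ℕ) :
    dist (uniformGrid t n (k + 1)) (uniformGrid t n k) = t / (n + 1) := by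
  rw [NNReal.dist_eq]
  simp only [uniformGrid, NNReal.coe_mul, NNReal.coe_div, NNReal.coe_add, NNReal.coe_natCast,
    NNReal.coe_one, Nat.cast_add, Nat.cast_one]
  rw [← mul_sub, ← sub_div, add_sub_cancel_left, mul_one_div]
  exact abs_of_nonneg (by positivity)

lemma exists_dist_uniformGrid_le {s t : ℝ≥0} (hst : s ≤ t) (n : ℕ) :
    ∃ k ≤ n + 1, dist (uniformGrid t n k) s ≤ t / (n + 1) := by
  rcases eq_or_ne t 0 with rfl | ht
  · exact ⟨0, by simp, by simp [uniformGrid, nonpos_iff_eq_zero.1 hst]⟩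
  have ht' : (0 : ℝ) < t := by positivity
  have hst' : (s : ℝ) ≤ t := hst
  set u : ℝ := s * (n + 1) / t with hu
  have hu0 : 0 ≤ u := by positivity
  have hsu : (s : ℝ) = t * (u / (n + 1)) := by rw [hu]; field_simp
  have h1 := Nat.floor_le hu0
  have h2 := Nat.lt_floor_add_one u
  refine ⟨⌊u⌋₊, ?_, ?_⟩
  · have : u ≤ (n + 1 : ℕ) := by
      rw [hu, div_le_iff₀ ht', mul_comm]; push_cast; gcongr
    exact Nat.floor_le_of_le this
  · rw [NNReal.dist_eq, hsu]
    simp only [uniformGrid, NNReal.coe_mul, NNReal.coe_div, NNReal.coe_add, NNReal.coe_natCast,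
      NNReal.coe_one]
    rw [← mul_sub, ← sub_div, ← mul_div_assoc, abs_div, abs_mul, abs_of_pos ht',
      abs_of_pos (by positivity : (0 : ℝ) < n + 1)]
    gcongr
    refine mul_le_of_le_one_right ht'.le ?_
    rw [abs_le]; constructor <;> linarith

lemma bddAbove_image_Icc {x : ℝ≥0 → ℝ} (hx : Continuous x) (t : ℝ≥0) :
    BddAbove (x '' Set.Icc 0 t) :=
  (isCompact_Icc.image hx).bddAbove

lemma lt_sSup_image_Icc_iff {x : ℝ≥0 → ℝ} (hx : Continuous x) (t : ℝ≥0) (b : ℝ) :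
    b < sSup (x '' Set.Icc 0 t) ↔ ∃ s ≤ t, b < x s := by
  rw [lt_csSup_iff (bddAbove_image_Icc hx t) ⟨x 0, 0, by simp, rfl⟩]
  simp

open Classical in
lemma sum_isFirstPassage_eq {b : ℝ} {x : ℕ → ℝ} {m N : ℕ} (hm : IsFirstPassage b x m)
    (hmN : m < N) (h : ℝ → ℝ) :
    (∑ k ∈ Finset.range N, if IsFirstPassage b x k then h (x k) else 0) = h (x m) := by
  rw [Finset.sum_eq_single m, if_pos hm]
  · intro k _ hk
    refine if_neg fun hk' => ?_
    rcases lt_or_gt_of_ne hk with h' | h'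
    · exact (hm.2 k h').not_gt hk'.1
    · exact (hk'.2 m h').not_gt hm.1
  · intro h'; exact absurd (Finset.mem_range.2 hmN) h'

open Classical in
lemma abs_sum_isFirstPassage_le {b C : ℝ} {x : ℕ → ℝ} {N : ℕ} {h : ℝ → ℝ} (hC : ∀ y, |h y| ≤ C) :
    |∑ k ∈ Finset.range N, if IsFirstPassage b x k then h (x k) else 0| ≤ C := by
  by_cases hm : ∃ m < N, IsFirstPassage b x m
  · obtain ⟨m, hmN, hm⟩ := hm
    rw [sum_isFirstPassage_eq hm hmN]
    exact hC _
  · push Not at hm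
    rw [Finset.sum_eq_zero fun k hk => if_neg (hm k (Finset.mem_range.1 hk))]
    simpa using (abs_nonneg _).trans (hC 0)

open Classical in
/-- Along finer and finer grids, the value of a continuous path at its first passage above `b`
converges to `b` if the path exceeds `b`. -/
lemma tendsto_sum_isFirstPassage {x : ℝ≥0 → ℝ} (hx : Continuous x) {b : ℝ} (hb : x 0 ≤ b)
    (t : ℝ≥0) {h : ℝ → ℝ} (hh : Continuous h) :
    Tendsto (fun n : ℕ => ∑ k ∈ Finset.range (n + 2),
        if IsFirstPassage b (fun j => x (uniformGrid t n j)) k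
          then h (x (uniformGrid t n k)) else 0) atTop
      (𝓝 (if b < sSup (x '' Set.Icc 0 t) then h b else 0)) := by
  split_ifs with hM
  · obtain ⟨s, hst, hs⟩ := (lt_sSup_image_Icc_iff hx t b).1 hM
    rw [Metric.tendsto_nhds]
    intro ε hε
    obtain ⟨δ, hδ, hδh⟩ := Metric.continuous_iff.1 hh b ε hε
    have huc := Metric.uniformContinuousOn_iff.1
      ((isCompact_Icc (a := (0 : ℝ≥0)) (b := t)).uniformContinuousOn_of_continuous hx.continuousOn)
    obtain ⟨η, hη, hηx⟩ := huc (min δ (x s - b)) (lt_min hδ (sub_pos.2 hs))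
    have hmesh : ∀ᶠ n : ℕ in atTop, (t : ℝ) / (n + 1) < η := by
      have : Tendsto (fun n : ℕ => (t : ℝ) / ((n + 1 : ℕ) : ℝ)) atTop (𝓝 0) :=
        (tendsto_const_div_atTop_nhds_zero_nat (t : ℝ)).comp (tendsto_add_atTop_nat 1)
      filter_upwards [this.eventually (gt_mem_nhds hη)] with n hn
      simpa using hn
    filter_upwards [hmesh] with n hn
    have hex : ∃ k, b < x (uniformGrid t n k) ∧ k ≤ n + 1 := by
      obtain ⟨k, hk, hks⟩ := exists_dist_uniformGrid_le hst n
      have := hηx _ ⟨zero_le, uniformGrid_le hk⟩ s ⟨zero_le, hst⟩ (hks.trans_lt hn)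
      rw [Real.dist_eq] at this
      have := (abs_lt.1 (this.trans_le (min_le_right _ _))).1
      exact ⟨k, by linarith, hk⟩
    set m := Nat.find hex with hm
    obtain ⟨hmb, hmn⟩ := Nat.find_spec hex
    have hfirst : IsFirstPassage b (fun j => x (uniformGrid t n j)) m := by
      refine ⟨hmb, fun j hj => ?_⟩
      have := Nat.find_min hex hj
      by_contra! hcon
      exact this ⟨hcon, by omega⟩
    rw [sum_isFirstPassage_eq hfirst (by omega)]
    refine hδh _ ?_
    have hm0 : m ≠ 0 := by
      intro h0
      have := hfirst.1
      simp only [h0, uniformGrid_zero] at this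
      exact hb.not_gt this
    obtain ⟨j, hj⟩ := Nat.exists_eq_succ_of_ne_zero hm0
    have hjb := hfirst.2 j (by omega)
    have := hηx (uniformGrid t n (j + 1)) ⟨zero_le, uniformGrid_le (by omega)⟩
      (uniformGrid t n j) ⟨zero_le, uniformGrid_le (by omega)⟩
      ((dist_uniformGrid_succ t n j).trans_lt hn)
    rw [Real.dist_eq] at this
    have h1 := (abs_lt.1 (this.trans_le (min_le_left _ _))).2
    have h2 := hfirst.1
    simp only [hj, Nat.succ_eq_add_one] at hjb h2 ⊢
    rw [Real.dist_eq, abs_of_pos (by linarith)]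
    linarith
  · have h0 : ∀ n : ℕ, (∑ k ∈ Finset.range (n + 2),
        if IsFirstPassage b (fun j => x (uniformGrid t n j)) k
          then h (x (uniformGrid t n k)) else 0) = 0 := by
      intro n
      refine Finset.sum_eq_zero fun k hk => if_neg fun hk' => hM ?_
      refine (lt_sSup_image_Icc_iff hx t b).2 ⟨_, uniformGrid_le ?_, hk'.1⟩
      have := Finset.mem_range.1 hk; omega
    simp only [h0]
    exact tendsto_const_nhds

/-- A process started at `v₀` with almost surely continuous paths, whose increments up to the
horizon `t` are symmetric and independent of the past. -/
structure HasSymmetricIncrements {Ω : Type*} [MeasurableSpace Ω] (X : ℝ≥0 → Ω → ℝ) (v₀ : ℝ)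
    (t : ℝ≥0) (P : Measure Ω) : Prop where
  aemeasurable : ∀ s, AEMeasurable (X s) P
  cont : ∀ᵐ ω ∂P, Continuous (X · ω)
  start : ∀ᵐ ω ∂P, X 0 ω = v₀
  indep : ∀ s ≤ t, IndepFun (fun ω => X t ω - X s ω) (fun ω (r : Set.Iic s) => X r ω) P
  symm : ∀ s ≤ t, IdentDistrib (fun ω => X t ω - X s ω) (fun ω => -(X t ω - X s ω)) P P

section

variable {Ω : Type*} [MeasurableSpace Ω] {P : Measure Ω} {X : ℝ≥0 → Ω → ℝ} {v₀ : ℝ} {t : ℝ≥0}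

lemma aemeasurable_runningMax (hm : ∀ s, AEMeasurable (X s) P)
    (hc : ∀ᵐ ω ∂P, Continuous (X · ω)) (t : ℝ≥0) : AEMeasurable (runningMax X t) P := by
  have : Nonempty (Set.Icc (0 : ℝ≥0) t) := ⟨⟨0, by simp⟩⟩
  set q := TopologicalSpace.denseSeq (Set.Icc (0 : ℝ≥0) t) with hq
  have hsup : AEMeasurable (fun ω => ⨆ n, X (q n) ω) P := .iSup fun n => hm _
  refine hsup.congr ?_
  filter_upwards [hc] with ω hω
  have hb : BddAbove (Set.range fun n => X (q n) ω) := by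
    refine (bddAbove_image_Icc hω t).mono ?_
    rintro _ ⟨n, rfl⟩
    exact ⟨q n, (q n).2, rfl⟩
  refine le_antisymm (ciSup_le fun n => ?_) (csSup_le ⟨X 0 ω, 0, by simp, rfl⟩ ?_)
  · exact le_csSup (bddAbove_image_Icc hω t) ⟨q n, (q n).2, rfl⟩
  · rintro _ ⟨s, hs, rfl⟩
    have hcl : IsClosed {r : Set.Icc (0 : ℝ≥0) t | X r ω ≤ ⨆ n, X (q n) ω} :=
      isClosed_le (hω.comp continuous_subtype_val) continuous_const
    have hsub : Set.range q ⊆ {r : Set.Icc (0 : ℝ≥0) t | X r ω ≤ ⨆ n, X (q n) ω} := by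
      rintro _ ⟨n, rfl⟩
      exact le_ciSup hb n
    have := (TopologicalSpace.denseRange_denseSeq (Set.Icc (0 : ℝ≥0) t)).closure_eq ▸
      hcl.closure_subset_iff.2 hsub
    exact this (Set.mem_univ (⟨s, hs⟩ : Set.Icc (0 : ℝ≥0) t))

lemma IsFirstPassage.nullMeasurableSet (hm : ∀ s, AEMeasurable (X s) P) (b : ℝ) (u : ℕ → ℝ≥0)
    (k : ℕ) : NullMeasurableSet {ω | IsFirstPassage b (fun j => X (u j) ω) k} P := by
  have : {ω | IsFirstPassage b (fun j => X (u j) ω) k} =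
      {ω | b < X (u k) ω} ∩ ⋂ j, ⋂ (_ : j < k), {ω | X (u j) ω ≤ b} := by
    ext ω; simp [IsFirstPassage]
  rw [this]
  exact (nullMeasurableSet_lt aemeasurable_const (hm _)).inter <| .iInter fun j =>
    .iInter fun _ => nullMeasurableSet_le (hm _) aemeasurable_const

open Classical in
/-- Reflecting the path after a first passage on a grid preserves the law at the horizon. -/
lemma HasSymmetricIncrements.integral_isFirstPassage [IsProbabilityMeasure P]
    (hX : HasSymmetricIncrements X v₀ t P) (b : ℝ) {u : ℕ → ℝ≥0} (hu : Monotone u) {k : ℕ}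
    (hk : u k ≤ t) {f : ℝ → ℝ} (hf : Measurable f) :
    ∫ ω, (if IsFirstPassage b (fun j => X (u j) ω) k then f (X t ω) else 0) ∂P =
      ∫ ω, (if IsFirstPassage b (fun j => X (u j) ω) k then f (2 * X (u k) ω - X t ω) else 0) ∂P := by
  let Y : Ω → Fin (k + 1) → ℝ := fun ω j => X (u j) ω
  let D : Ω → ℝ := fun ω => X t ω - X (u k) ω
  have hYm : AEMeasurable Y P := aemeasurable_pi_lambda _ fun j => hX.aemeasurable _
  have hind : IndepFun Y D P := by
    have := (hX.indep _ hk).comp (φ := id)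
      (ψ := fun x (j : Fin (k + 1)) => x ⟨u j, hu (Nat.lt_succ_iff.1 j.2)⟩) measurable_id
      (measurable_pi_lambda _ fun j => measurable_pi_apply _)
    exact this.symm
  have hind' : IndepFun Y (fun ω => -D ω) P := hind.comp measurable_id measurable_neg
  have hid : IdentDistrib (fun ω => (Y ω, D ω)) (fun ω => (Y ω, -D ω)) P P :=
    (IdentDistrib.refl hYm).prodMk (hX.symm _ hk) hind hind'
  let A : Set ((Fin (k + 1) → ℝ) × ℝ) :=
    {z | b < z.1 (Fin.last k) ∧ ∀ j : Fin k, z.1 j.castSucc ≤ b}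
  have hA : MeasurableSet A := by
    have : A = {z | b < z.1 (Fin.last k)} ∩ ⋂ j : Fin k, {z | z.1 j.castSucc ≤ b} := by
      ext z; simp [A]
    rw [this]
    exact (measurableSet_lt (by fun_prop) (by fun_prop)).inter <| .iInter fun j =>
      measurableSet_le (by fun_prop) (by fun_prop)
  let G : (Fin (k + 1) → ℝ) × ℝ → ℝ := fun z => if z ∈ A then f (z.1 (Fin.last k) + z.2) else 0
  have hG : Measurable G :=
    Measurable.ite hA (hf.comp (by fun_prop)) measurable_const
  have hiff : ∀ ω d, (Y ω, d) ∈ A ↔ IsFirstPassage b (fun j => X (u j) ω) k := by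
    intro ω d
    simp only [A, Y, IsFirstPassage, Set.mem_ofPred_eq, Fin.val_last, Fin.val_castSucc]
    exact and_congr_right fun _ => ⟨fun h j hj => h ⟨j, hj⟩, fun h j => h j j.2⟩
  have := (hid.comp hG).integral_eq
  simp only [Function.comp_def, G, hiff] at this
  convert this using 4 with ω ω
  · simp [Y, D]
  · simp only [Y, D, Fin.val_last]; congr 1; ring

open Classical in
lemma HasSymmetricIncrements.tendsto_integral_sum_isFirstPassage [IsProbabilityMeasure P]
    (hX : HasSymmetricIncrements X v₀ t P) {b : ℝ} (hb : v₀ ≤ b) {h : Ω → ℝ → ℝ} {C : ℝ}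
    (hC : ∀ ω y, |h ω y| ≤ C) (hc : ∀ ω, Continuous (h ω))
    (hm : ∀ s, AEMeasurable (fun ω => h ω (X s ω)) P) :
    Tendsto (fun n : ℕ => ∫ ω, ∑ k ∈ Finset.range (n + 2),
        (if IsFirstPassage b (fun j => X (uniformGrid t n j) ω) k
          then h ω (X (uniformGrid t n k) ω) else 0) ∂P) atTop
      (𝓝 (∫ ω in {ω | b < runningMax X t ω}, h ω b ∂P)) := by
  have hnull : NullMeasurableSet {ω | b < runningMax X t ω} P :=
    nullMeasurableSet_lt aemeasurable_const (aemeasurable_runningMax hX.aemeasurable hX.cont t)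
  rw [← integral_indicator₀ hnull]
  refine tendsto_integral_of_dominated_convergence (fun _ => C) (fun n => ?_)
    (integrable_const _) (fun n => ae_of_all _ fun ω => ?_) ?_
  · refine AEMeasurable.aestronglyMeasurable (Finset.aemeasurable_fun_sum _ fun k _ => ?_)
    have := (hm (uniformGrid t n k)).indicator₀
      (IsFirstPassage.nullMeasurableSet hX.aemeasurable b (uniformGrid t n) k)
    exact this.congr (ae_of_all _ fun ω => by simp [Set.indicator_apply])
  · exact abs_sum_isFirstPassage_le (x := fun j => X (uniformGrid t n j) ω) (hC ω)
  · filter_upwards [hX.cont, hX.start] with ω hω h0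
    have := tendsto_sum_isFirstPassage hω (b := b) (by rw [h0]; exact hb) t (hc ω)
    simpa only [Set.indicator_apply, Set.mem_ofPred_eq, runningMax] using this

/-- **Reflection principle**: on the event that the running maximum exceeds `b`, the law of the
terminal value is invariant under the reflection at `b`. -/
theorem HasSymmetricIncrements.map_restrict_eq_map_reflect [IsProbabilityMeasure P]
    (hX : HasSymmetricIncrements X v₀ t P) {b : ℝ} (hb : v₀ ≤ b) :
    (P.restrict {ω | b < runningMax X t ω}).map (X t) =
      (P.restrict {ω | b < runningMax X t ω}).map (fun ω => 2 * b - X t ω) := by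
  classical
  have hmt := hX.aemeasurable t
  refine ext_of_forall_integral_eq_of_IsFiniteMeasure fun f => ?_
  rw [integral_map hmt.restrict (by fun_prop),
    integral_map (hmt.const_sub (2 * b)).restrict f.continuous.aestronglyMeasurable]
  have h1 := hX.tendsto_integral_sum_isFirstPassage hb (h := fun ω _ => f (X t ω)) (C := ‖f‖)
    (fun ω y => f.norm_coe_le_norm _) (fun ω => continuous_const)
    (fun s => f.continuous.measurable.comp_aemeasurable hmt)
  have h2 := hX.tendsto_integral_sum_isFirstPassage hb (h := fun ω y => f (2 * y - X t ω))
    (C := ‖f‖) (fun ω y => f.norm_coe_le_norm _) (fun ω => by fun_prop)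
    (fun s => f.continuous.measurable.comp_aemeasurable
      (((hX.aemeasurable s).const_mul 2).sub hmt))
  refine tendsto_nhds_unique h1 (h2.congr fun n => ?_)
  have hint : ∀ (k : ℕ) (g : Ω → ℝ), AEMeasurable g P → (∃ C, ∀ ω, ‖g ω‖ ≤ C) →
      Integrable (fun ω => if IsFirstPassage b (fun j => X (uniformGrid t n j) ω) k
        then g ω else 0) P := by
    rintro k g hg ⟨C, hC⟩
    have : Integrable g P := .of_bound hg.aestronglyMeasurable C (ae_of_all _ hC)
    exact (this.indicator₀ (IsFirstPassage.nullMeasurableSet hX.aemeasurable b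
      (uniformGrid t n) k)).congr (ae_of_all _ fun ω => by simp [Set.indicator_apply])
  rw [integral_finsetSum, integral_finsetSum]
  · refine Finset.sum_congr rfl fun k hk => ?_
    exact (hX.integral_isFirstPassage b (uniformGrid_mono t n)
      (uniformGrid_le (by have := Finset.mem_range.1 hk; omega)) f.continuous.measurable).symm
  · exact fun k _ => hint k _ (f.continuous.measurable.comp_aemeasurable hmt)
      ⟨‖f‖, fun ω => f.norm_coe_le_norm _⟩
  · exact fun k _ => hint k _ (f.continuous.measurable.comp_aemeasurable
      (((hX.aemeasurable _).const_mul 2).sub hmt)) ⟨‖f‖, fun ω => f.norm_coe_le_norm _⟩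

/-- The joint law of the running maximum and the terminal value, below the level `b`. -/
lemma HasSymmetricIncrements.measure_lt_runningMax_inter [IsProbabilityMeasure P]
    (hX : HasSymmetricIncrements X v₀ t P) {b : ℝ} (hb : v₀ ≤ b) {A : Set ℝ}
    (hA : MeasurableSet A) (hAb : A ⊆ Set.Iio b) :
    P (X t ⁻¹' A ∩ {ω | b < runningMax X t ω}) = P.map (fun ω => 2 * b - X t ω) A := by
  have hmt := hX.aemeasurable t
  have hnull : NullMeasurableSet {ω | b < runningMax X t ω} P :=
    nullMeasurableSet_lt aemeasurable_const (aemeasurable_runningMax hX.aemeasurable hX.cont t)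
  have h := congrArg (· A) (hX.map_restrict_eq_map_reflect hb)
  simp only [Measure.map_apply_of_aemeasurable hmt.restrict hA,
    Measure.map_apply_of_aemeasurable (hmt.const_sub (2 * b)).restrict hA,
    Measure.restrict_apply₀' hnull] at h
  rw [h, Measure.map_apply_of_aemeasurable (hmt.const_sub (2 * b)) hA]
  refine measure_congr ?_
  filter_upwards [hX.cont] with ω hω
  refine propext (and_iff_left_of_imp fun hωA => ?_)
  have : 2 * b - X t ω < b := hAb hωA
  exact (lt_sSup_image_Icc_iff hω t b).2 ⟨t, le_rfl, by linarith⟩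

end

open scoped ENNReal in
/-- The averages of a continuous function over shrinking balls converge to its value at the
centre. -/
lemma tendsto_inv_mul_setLIntegral_ball {μ : Measure ℝ} [IsFiniteMeasure μ] [μ.IsOpenPosMeasure]
    {g : ℝ → ℝ≥0∞} (x : ℝ) (hg : ContinuousAt g x) :
    Tendsto (fun ε : ℝ => (μ (Metric.ball x ε))⁻¹ * ∫⁻ y in Metric.ball x ε, g y ∂μ)
      (𝓝[>] 0) (𝓝 (g x)) := by
  have hball : ∀ {p : ℝ≥0∞ → Prop}, (∀ᶠ z in 𝓝 (g x), p z) →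
      ∀ᶠ ε in 𝓝[>] (0 : ℝ), 0 < ε ∧ ∀ y ∈ Metric.ball x ε, p (g y) := by
    intro p hp
    obtain ⟨δ, hδ, hδp⟩ := Metric.eventually_nhds_iff_ball.1 (hg.eventually hp)
    filter_upwards [Ioo_mem_nhdsGT hδ] with ε hε
    exact ⟨hε.1, fun y hy => hδp y (Metric.ball_subset_ball hε.2.le hy)⟩
  have hconst : ∀ {ε : ℝ} (c : ℝ≥0∞), 0 < ε →
      (μ (Metric.ball x ε))⁻¹ * (c * μ (Metric.ball x ε)) = c := by
    intro ε c hε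
    rw [mul_comm c, ← mul_assoc, ENNReal.inv_mul_cancel (Metric.measure_ball_pos μ x hε).ne'
      (measure_ne_top _ _), one_mul]
  refine tendsto_order.2 ⟨fun a ha => ?_, fun a ha => ?_⟩
  · obtain ⟨c, hac, hc⟩ := exists_between ha
    filter_upwards [hball (lt_mem_nhds hc)] with ε ⟨hε, h⟩
    refine hac.trans_le ?_
    rw [← hconst c hε, ← setLIntegral_const]
    gcongr 1
    exact setLIntegral_mono' measurableSet_ball fun y hy => (h y hy).le
  · obtain ⟨c, hc, hac⟩ := exists_between ha
    filter_upwards [hball (gt_mem_nhds hc)] with ε ⟨hε, h⟩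
    refine lt_of_le_of_lt ?_ hac
    rw [← hconst c hε, ← setLIntegral_const]
    gcongr 1
    exact setLIntegral_mono' measurableSet_ball fun y hy => (h y hy).le

/-- The conditional probability that a Brownian motion with variance `v` at the horizon exceeds
the level `b`, given its terminal value `x`. -/
noncomputable def crossingProb (v₀ v b x : ℝ) : ℝ :=
  Real.exp (-(2 * b ^ 2 - 2 * b * (x + v₀) + 2 * x * v₀) / v)

lemma continuous_crossingProb_left (v₀ v x : ℝ) : Continuous fun b => crossingProb v₀ v b x := by
  unfold crossingProb; fun_prop

lemma continuous_crossingProb (v₀ v b : ℝ) : Continuous (crossingProb v₀ v b) := by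
  unfold crossingProb; fun_prop

lemma crossingProb_nonneg (v₀ v b x : ℝ) : 0 ≤ crossingProb v₀ v b x := (Real.exp_pos _).le

lemma gaussianPDF_reflect (v₀ b x : ℝ) {v : ℝ≥0} (hv : v ≠ 0) :
    gaussianPDF (2 * b - v₀) v x =
      gaussianPDF v₀ v x * ENNReal.ofReal (crossingProb v₀ v b x) := by
  rw [gaussianPDF, gaussianPDF, ← ENNReal.ofReal_mul (gaussianPDFReal_nonneg _ _ _)]
  congr 1
  have : (v : ℝ) ≠ 0 := by exact_mod_cast hv
  rw [gaussianPDFReal, gaussianPDFReal, crossingProb, mul_assoc _ (Real.exp _),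
    ← Real.exp_add]
  congr 2
  field_simp
  ring

section

variable {Ω : Type*} [MeasurableSpace Ω] {P : Measure Ω}
  {V : ℝ≥0 → Ω → ℝ} {v₀ σ : ℝ} {t : ℝ≥0}

lemma IsDriftlessBrownianMotion.hasLaw (hV : IsDriftlessBrownianMotion V v₀ σ P) (t : ℝ≥0) :
    HasLaw (V t) (gaussianReal v₀ (.mk (σ ^ 2) (sq_nonneg _) * t)) P := by
  obtain ⟨B, hB, hVB⟩ := hV
  have := gaussianReal_const_add (gaussianReal_const_mul (hB.hasLaw_eval t) σ) v₀
  have hVt : V t = fun ω => v₀ + σ * B t ω := funext (hVB t)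
  simpa [hVt] using this

lemma IsDriftlessBrownianMotion.hasSymmetricIncrements (hV : IsDriftlessBrownianMotion V v₀ σ P)
    (t : ℝ≥0) : HasSymmetricIncrements V v₀ t P := by
  have hm := fun s => (hV.hasLaw s).aemeasurable
  obtain ⟨B, hB, hVB⟩ := hV
  refine ⟨hm, ?_, ?_, fun s hs => ?_, fun s hs => ?_⟩
  · filter_upwards [hB.cont] with ω hω
    simp only [hVB]
    fun_prop
  · filter_upwards [hB.eval_zero_ae_eq_zero] with ω hω
    simp [hVB, hω]
  · have := (hB.indepFun_shift s).comp (φ := fun x => σ * x (t - s))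
      (ψ := fun x r => v₀ + σ * x r) (by fun_prop) (by fun_prop)
    convert this using 1
    · ext ω
      simp only [hVB, Function.comp_def, add_tsub_cancel_of_le hs]
      ring
    · ext ω r
      simp [hVB]
  · have hD := gaussianReal_const_mul (hB.hasLaw_sub t s) σ
    have hD' := gaussianReal_neg hD
    have hfun : (fun ω => V t ω - V s ω) = fun ω => σ * (B t - B s) ω := by
      ext ω; simp only [hVB, Pi.sub_apply]; ring
    have hfun' : (fun ω => -(V t ω - V s ω)) = -fun ω => σ * (B t - B s) ω := by
      rw [← hfun]; rfl
    rw [hfun', hfun]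
    refine ⟨hD.aemeasurable, hD'.aemeasurable, ?_⟩
    rw [hD.map_eq, hD'.map_eq]
    simp

lemma IsDriftlessBrownianMotion.aemeasurable_runningMax
    (hV : IsDriftlessBrownianMotion V v₀ σ P) : AEMeasurable (runningMax V t) P :=
  _root_.aemeasurable_runningMax (hV.hasSymmetricIncrements t).aemeasurable
    (hV.hasSymmetricIncrements t).cont t

lemma IsDriftlessBrownianMotion.isOpenPosMeasure_map (hV : IsDriftlessBrownianMotion V v₀ σ P)
    (hσ : 0 < σ) (ht : 0 < t) : (P.map (V t)).IsOpenPosMeasure := by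
  rw [(hV.hasLaw t).map_eq]
  refine (gaussianReal_absolutelyContinuous' v₀ (mul_ne_zero (fun h => ?_) ht.ne')).isOpenPosMeasure
  have : σ ^ 2 = 0 := congrArg NNReal.toReal h
  exact hσ.ne' (by simpa using this)

variable [IsProbabilityMeasure P]

/-- The joint law of the running maximum and the terminal value has the density `crossingProb`
with respect to the law of the terminal value. -/
lemma IsDriftlessBrownianMotion.measure_lt_runningMax_inter
    (hV : IsDriftlessBrownianMotion V v₀ σ P) (hσ : 0 < σ) (ht : 0 < t) {b : ℝ} (hb : v₀ ≤ b)
    {A : Set ℝ} (hA : MeasurableSet A) (hAb : A ⊆ Set.Iio b) :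
    P (V t ⁻¹' A ∩ {ω | b < runningMax V t ω}) =
      ∫⁻ x in A, ENNReal.ofReal (crossingProb v₀ (σ ^ 2 * t) b x) ∂(P.map (V t)) := by
  have hlaw := hV.hasLaw t
  set v : ℝ≥0 := .mk (σ ^ 2) (sq_nonneg _) * t with hv
  have hv0 : v ≠ 0 := by
    refine mul_ne_zero (fun h => ?_) ht.ne'
    have : σ ^ 2 = 0 := congrArg NNReal.toReal h
    exact hσ.ne' (by simpa using this)
  have hvr : σ ^ 2 * (t : ℝ) = v := by simp [hv]
  rw [(hV.hasSymmetricIncrements t).measure_lt_runningMax_inter hb hA hAb]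
  have hmap : P.map (fun ω => 2 * b - V t ω) = gaussianReal (2 * b - v₀) v := by
    rw [← gaussianReal_map_const_sub, ← hlaw.map_eq,
      AEMeasurable.map_map_of_aemeasurable (by fun_prop) hlaw.aemeasurable]
    rfl
  rw [hmap, hlaw.map_eq, gaussianReal_apply _ hv0, gaussianReal_of_var_ne_zero _ hv0,
    setLIntegral_withDensity_eq_setLIntegral_mul _ (measurable_gaussianPDF _ _)
      (continuous_crossingProb _ _ _).measurable.ennreal_ofReal hA, hvr]
  simp only [gaussianPDF_reflect _ _ _ hv0, Pi.mul_apply]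

/-- The crossing probability as the limit of elementary conditional probabilities. -/
theorem IsDriftlessBrownianMotion.tendsto_cond (hV : IsDriftlessBrownianMotion V v₀ σ P)
    (hσ : 0 < σ) (ht : 0 < t) {b x : ℝ} (hb : v₀ ≤ b) (hx : x < b) :
    Tendsto (fun ε : ℝ => (ProbabilityTheory.cond P {ω | |V t ω - x| < ε}).real
        {ω | b < runningMax V t ω})
      (𝓝[>] 0) (𝓝 (crossingProb v₀ (σ ^ 2 * t) b x)) := by
  have hmt := (hV.hasLaw t).aemeasurable
  have := hV.isOpenPosMeasure_map hσ ht
  have := Measure.isProbabilityMeasure_map (μ := P) hmt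
  have hlim := tendsto_inv_mul_setLIntegral_ball (μ := P.map (V t)) x
    (ENNReal.continuous_ofReal.comp (continuous_crossingProb v₀ (σ ^ 2 * t) b)).continuousAt
  have hlim' := (ENNReal.tendsto_toReal ENNReal.ofReal_ne_top).comp hlim
  rw [ENNReal.toReal_ofReal (crossingProb_nonneg _ _ _ _)] at hlim'
  refine hlim'.congr' ?_
  filter_upwards [Ioo_mem_nhdsGT (sub_pos.2 hx)] with ε hε
  have hset : {ω | |V t ω - x| < ε} = V t ⁻¹' Metric.ball x ε := by
    ext ω; simp [Real.dist_eq]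
  have hsub : Metric.ball x ε ⊆ Set.Iio b := by
    intro y hy
    have := (abs_lt.1 (Real.dist_eq y x ▸ Metric.mem_ball.1 hy)).2
    have := hε.2
    exact Set.mem_Iio.2 (by linarith)
  rw [Function.comp_apply, hset, measureReal_def, ProbabilityTheory.cond, Measure.smul_apply, smul_eq_mul,
    Measure.restrict_apply₀' (hmt.nullMeasurableSet_preimage measurableSet_ball), Set.inter_comm,
    hV.measure_lt_runningMax_inter hσ ht hb measurableSet_ball hsub,
    Measure.map_apply_of_aemeasurable hmt measurableSet_ball]
  rfl

lemma IsDriftlessBrownianMotion.condDistrib_runningMax_Ioi_ae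
    (hV : IsDriftlessBrownianMotion V v₀ σ P) (hσ : 0 < σ) (ht : 0 < t) {b : ℝ} (hb : v₀ ≤ b) :
    ∀ᵐ x ∂(P.map (V t)), x < b → condDistrib (runningMax V t) (V t) P x (Set.Ioi b) =
      ENNReal.ofReal (crossingProb v₀ (σ ^ 2 * t) b x) := by
  have hmt := (hV.hasLaw t).aemeasurable
  have hM := hV.aemeasurable_runningMax (t := t)
  have := Measure.isProbabilityMeasure_map (μ := P) hmt
  refine (ae_restrict_iff' measurableSet_Iio).1 (ae_eq_of_forall_setLIntegral_eq_of_sigmaFinite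
    (μ := (P.map (V t)).restrict (Set.Iio b)) (Kernel.measurable_coe _ measurableSet_Ioi)
    (continuous_crossingProb _ _ _).measurable.ennreal_ofReal fun A hA _ => ?_)
  rw [Measure.restrict_restrict hA,
    ← hV.measure_lt_runningMax_inter hσ ht hb (hA.inter measurableSet_Iio) Set.inter_subset_right,
    ← Measure.compProd_apply_prod (hA.inter measurableSet_Iio) measurableSet_Ioi,
    compProd_map_condDistrib hM, Measure.map_apply_of_aemeasurable (hmt.prodMk hM)
      ((hA.inter measurableSet_Iio).prod measurableSet_Ioi)]
  rfl

/-- The crossing probability as a regular conditional distribution. -/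
theorem IsDriftlessBrownianMotion.condDistrib_runningMax_Ioi
    (hV : IsDriftlessBrownianMotion V v₀ σ P) (hσ : 0 < σ) (ht : 0 < t) :
    ∀ᵐ x ∂(P.map (V t)), ∀ b, v₀ ≤ b → x < b →
      (condDistrib (runningMax V t) (V t) P x).real (Set.Ioi b) =
        crossingProb v₀ (σ ^ 2 * t) b x := by
  have hrat : ∀ᵐ x ∂(P.map (V t)), ∀ q : ℚ, v₀ ≤ (q : ℝ) → x < (q : ℝ) →
      condDistrib (runningMax V t) (V t) P x (Set.Ioi (q : ℝ)) =
        ENNReal.ofReal (crossingProb v₀ (σ ^ 2 * t) q x) := by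
    refine ae_all_iff.2 fun q => ?_
    by_cases hq : v₀ ≤ q
    · filter_upwards [hV.condDistrib_runningMax_Ioi_ae hσ ht hq] with x hx _ using hx
    · exact ae_of_all _ fun x h => absurd h hq
  filter_upwards [hrat] with x hx b hb hxb
  obtain ⟨u, hanti, hub, hu⟩ := Real.exists_seq_rat_strictAnti_tendsto b
  have hunion : Set.Ioi b = ⋃ n, Set.Ioi (u n : ℝ) := by
    ext y
    simp only [Set.mem_Ioi, Set.mem_iUnion]
    refine ⟨fun h => (hu.eventually (gt_mem_nhds h)).exists, fun ⟨n, hn⟩ => (hub n).trans hn⟩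
  have hmono : Monotone fun n => Set.Ioi (u n : ℝ) := fun m n hmn =>
    Set.Ioi_subset_Ioi (by exact_mod_cast hanti.antitone hmn)
  have h1 := tendsto_measure_iUnion_atTop (μ := condDistrib (runningMax V t) (V t) P x) hmono
  rw [← hunion] at h1
  have h2 : Tendsto (fun n => ENNReal.ofReal (crossingProb v₀ (σ ^ 2 * t) (u n) x)) atTop
      (𝓝 (ENNReal.ofReal (crossingProb v₀ (σ ^ 2 * t) b x))) :=
    ENNReal.tendsto_ofReal (((continuous_crossingProb_left v₀ (σ ^ 2 * t) x).tendsto b).comp hu)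
  have h3 := tendsto_nhds_unique h1 (h2.congr fun n =>
    (hx (u n) (hb.trans (hub n).le) (hxb.trans (hub n))).symm)
  rw [measureReal_def, h3, ENNReal.toReal_ofReal (crossingProb_nonneg _ _ _ _)]

end

theorem mainTheorem1 {Ω : Type*} [MeasurableSpace Ω] (P : Measure Ω) [IsProbabilityMeasure P]
    (V : ℝ≥0 → Ω → ℝ) (v₀ σ : ℝ) (hσ : 0 < σ) (hV : IsDriftlessBrownianMotion V v₀ σ P)
    (t : ℝ≥0) (ht : 0 < t) :
    -- the limit of the conditional probabilities given `|V_t - x| < ε`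
    (∀ b x : ℝ, v₀ ≤ b → x < b →
      Tendsto
        (fun ε : ℝ => (ProbabilityTheory.cond P {ω | |V t ω - x| < ε}).real
          {ω | b < runningMax V t ω})
        (𝓝[>] 0)
        (𝓝 (Real.exp (-(2 * b ^ 2 - 2 * b * (x + v₀) + 2 * x * v₀) / (σ ^ 2 * t))))) ∧
    -- the regular conditional distribution of the maximum given `V_t = x`
    (∀ᵐ x ∂(P.map (V t)), ∀ b : ℝ, v₀ ≤ b → x < b →
      (condDistrib (runningMax V t) (V t) P x).real (Set.Ioi b) =
        Real.exp (-(2 * b ^ 2 - 2 * b * (x + v₀) + 2 * x * v₀) / (σ ^ 2 * t))) ∧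
    -- the exceedance of the level `y` above the collateral `C₀`, in both senses
    (∀ C₀ y x : ℝ, v₀ ≤ y + C₀ → x < y + C₀ →
      Tendsto
        (fun ε : ℝ => (ProbabilityTheory.cond P {ω | |V t ω - x| < ε}).real
          {ω | y < runningMax V t ω - C₀})
        (𝓝[>] 0)
        (𝓝 (Real.exp (-(2 * (y + C₀) ^ 2 - 2 * (y + C₀) * (x + v₀) + 2 * x * v₀)
          / (σ ^ 2 * t))))) ∧
    (∀ C₀ : ℝ, ∀ᵐ x ∂(P.map (V t)), ∀ y : ℝ, v₀ ≤ y + C₀ → x < y + C₀ →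
      (condDistrib (fun ω => runningMax V t ω - C₀) (V t) P x).real (Set.Ioi y) =
        Real.exp (-(2 * (y + C₀) ^ 2 - 2 * (y + C₀) * (x + v₀) + 2 * x * v₀)
          / (σ ^ 2 * t))) := by
  refine ⟨fun b x hb hx => hV.tendsto_cond hσ ht hb hx, hV.condDistrib_runningMax_Ioi hσ ht,
    fun C₀ y x hb hx => ?_, fun C₀ => ?_⟩
  · simp only [lt_sub_iff_add_lt]
    exact hV.tendsto_cond hσ ht hb hx
  · have hsub : Measurable fun m : ℝ => m - C₀ := by fun_prop
    filter_upwards [hV.condDistrib_runningMax_Ioi hσ ht,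
      condDistrib_comp (V t) hV.aemeasurable_runningMax hsub] with x hx hcomp y hb hxb
    have hpre : (fun m : ℝ => m - C₀) ⁻¹' Set.Ioi y = Set.Ioi (y + C₀) := by
      ext m; simp
    rw [← Function.comp_def (fun m : ℝ => m - C₀), hcomp, measureReal_def,
      Kernel.map_apply' _ hsub _ measurableSet_Ioi, hpre, ← measureReal_def]
    exact hx _ hb hxb
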